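/- Let $q \ge 150$ be an integer, let $\chi$ be a primitive Dirichlet character modulo $q$, and let $L(s,\chi)$ denote its (analytically continued) Dirichlet $L$-function. For a primitive character $\chi$, let $\gamma_n(\chi)$ ($n \ge 0$) denote its Laurent–Stieltjes constants, defined by the Laurent expansion at $s=1$ $$L(s,\chi)=\frac{\delta_\chi}{s-1}+\sum_{n\ge 0}\frac{(-1)^n\gamma_n(\chi)}{n!}(s-1)^n,$$ where $\delta_\chi=1$ if $\chi$ is principal and $\delta_\chi=0$ otherwise (so for non-principal $\chi$, in particular for $q \ge 150$, $(-1)^n\gamma_n(\chi)=L^{(n)}(1,\chi)$). Put $N = 4\log q$. Then for every complex number $s$ with $|s-1|\le e^{-1}$, $$\left|L(s,\chi)-\sum_{0\le n\le N}\frac{(-1)^n\gamma_n(\chi)}{n!}(s-1)^n\right|\le \frac{32.3}{q^{2.5}}.$$ -/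

import Mathlib

open scoped Topology

noncomputable section

namespace LaurentStieltjes

/-- `δ_χ = 1` if `χ` is principal, and `δ_χ = 0` otherwise. For a primitive character this is the
residue of `L(s, χ)` at `s = 1`, because the only primitive principal character is the one
modulo `1`, with `L(s, χ) = ζ(s)`. -/
def polarCoeff {q : ℕ} (χ : DirichletCharacter ℂ q) : ℂ :=
  open Classical in if χ = 1 then 1 else 0

/-- The regular part `L(s, χ) - δ_χ / (s - 1)` of the Laurent expansion at `s = 1`, with the
removable singularity at `s = 1` filled in. Here `DirichletCharacter.LFunction χ` is the
analytically continued `L`-function. -/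
def regularPart {q : ℕ} [NeZero q] (χ : DirichletCharacter ℂ q) : ℂ → ℂ :=
  Function.update (fun s => χ.LFunction s - polarCoeff χ / (s - 1)) 1
    (Filter.limUnder (𝓝[≠] (1 : ℂ)) (fun s => χ.LFunction s - polarCoeff χ / (s - 1)))

/-- The `n`-th Laurent-Stieltjes constant `γ_n(χ)` of a primitive Dirichlet character `χ`: the
number such that `(-1)^n γ_n(χ) / n!` is the coefficient of `(s - 1)^n` in the Laurent expansion
of `L(s, χ)` at `s = 1`, see `hasSum_laurent`. For `χ` non-principal, `(-1)^n γ_n(χ)` is the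
`n`-th derivative of `L(s, χ)` at `s = 1`, see `laurentStieltjes_of_ne_one`. -/
def laurentStieltjes {q : ℕ} [NeZero q] (χ : DirichletCharacter ℂ q) (n : ℕ) : ℂ :=
  (-1) ^ n * iteratedDeriv n (regularPart χ) 1

theorem regularPart_of_ne_one {q : ℕ} [NeZero q] {χ : DirichletCharacter ℂ q} (hχ : χ ≠ 1) :
    regularPart χ = χ.LFunction := by
  have hf : (fun s => χ.LFunction s - polarCoeff χ / (s - 1)) = χ.LFunction := by
    funext s
    simp [polarCoeff, hχ]
  have hc : ContinuousAt χ.LFunction 1 :=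
    (DirichletCharacter.differentiable_LFunction hχ 1).continuousAt
  have hl : Filter.limUnder (𝓝[≠] (1 : ℂ)) χ.LFunction = χ.LFunction 1 :=
    (hc.tendsto.mono_left nhdsWithin_le_nhds).limUnder_eq
  rw [regularPart, hf, hl, Function.update_eq_self]

theorem laurentStieltjes_of_ne_one {q : ℕ} [NeZero q] {χ : DirichletCharacter ℂ q} (hχ : χ ≠ 1)
    (n : ℕ) : (-1) ^ n * laurentStieltjes χ n = iteratedDeriv n χ.LFunction 1 := by
  rw [laurentStieltjes, regularPart_of_ne_one hχ, ← mul_assoc, ← mul_pow]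
  simp

theorem differentiable_regularPart {q : ℕ} [NeZero q] {χ : DirichletCharacter ℂ q}
    (hp : χ.IsPrimitive) : Differentiable ℂ (regularPart χ) := by
  by_cases hχ : χ = 1
  · have hq : q = 1 := by
      rw [← (DirichletCharacter.isPrimitive_def χ).mp hp, hχ, DirichletCharacter.conductor_one]
    subst hq
    have hf : (fun s => χ.LFunction s - polarCoeff χ / (s - 1))
        = fun s => riemannZeta s - 1 / (s - 1) := by
      funext s
      simp [polarCoeff, hχ]
    rw [regularPart, hf, tendsto_riemannZeta_sub_one_div.limUnder_eq, ← differentiableOn_univ,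
      ← Complex.differentiableOn_compl_singleton_and_continuousAt_iff
        (Filter.univ_mem : Set.univ ∈ 𝓝 (1 : ℂ))]
    refine ⟨?_, continuousAt_update_same.mpr tendsto_riemannZeta_sub_one_div⟩
    have hd : DifferentiableOn ℂ (fun s : ℂ => riemannZeta s - 1 / (s - 1)) (Set.univ \ {1}) := by
      intro s hs
      have hs' : s ≠ 1 := hs.2
      have h1 : s - 1 ≠ 0 := sub_ne_zero.mpr hs'
      refine DifferentiableAt.differentiableWithinAt ?_
      exact (differentiableAt_riemannZeta hs').sub
        ((differentiableAt_const _).div (differentiableAt_id.sub_const 1) h1)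
    exact hd.congr fun s hs => Function.update_of_ne hs.2 _ _
  · rw [regularPart_of_ne_one hχ]
    exact DirichletCharacter.differentiable_LFunction hχ

/-- The Laurent expansion that determines the constants `γ_n(χ)`. -/
theorem hasSum_laurent {q : ℕ} [NeZero q] {χ : DirichletCharacter ℂ q} (hp : χ.IsPrimitive)
    {s : ℂ} (hs : s ≠ 1) :
    HasSum (fun n : ℕ => (-1) ^ n * laurentStieltjes χ n / (n.factorial : ℂ) * (s - 1) ^ n)
      (χ.LFunction s - polarCoeff χ / (s - 1)) := by
  have h := Complex.hasSum_taylorSeries_of_entire (differentiable_regularPart hp) 1 s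
  rw [regularPart, Function.update_of_ne hs, ← regularPart] at h
  have hfun : (fun n : ℕ => (-1) ^ n * laurentStieltjes χ n / (n.factorial : ℂ) * (s - 1) ^ n)
      = fun n : ℕ => (n.factorial : ℂ)⁻¹ • (s - 1) ^ n • iteratedDeriv n (regularPart χ) 1 := by
    funext n
    have h1 : ((-1 : ℂ) ^ n) * (-1) ^ n = 1 := by rw [← mul_pow]; simp
    rw [laurentStieltjes, ← mul_assoc, h1, smul_eq_mul, smul_eq_mul]
    ring
  rw [hfun]
  exact h

end LaurentStieltjes

end

/-!
A primitive character modulo `q ≥ 150` is not principal, so `L(s, χ)` is entire and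
`(-1)^n γ_n(χ) / n!` is its `n`-th Taylor coefficient at `1`. By Cauchy's estimate, a bound
`|L(s, χ)| ≤ C` on a circle `|s - 1| = R` controls the remainder of the Taylor polynomial on
`|s - 1| ≤ r < R` by a geometric series with ratio `r / R`
(`norm_sub_sum_taylor_le`).

For the bound on the circle no functional equation is needed. The partial sums
`S(t) = ∑_{k ≤ t} χ(k)` are periodic, whence `|S(t)| ≤ min(t, q)`, and Abel summation gives
`L(s, χ) = s ∫_1^∞ S(t) t^(-s-1) dt`, first for `Re s > 1` and then for `Re s > 0` by analytic
continuation (`LFunction_eq_mul_integral`). Splitting the integral at `t = q` yields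
`|L(s, χ)| ≤ |s| q^(1-σ) / (σ (1-σ))` for `Re s ≥ σ`, `0 < σ < 1` (`norm_LFunction_le`).

The choice `R = e^(-1/10)` makes the ratio `e^(-9/10)`, whose power with exponent `4 log q` is
`q^(-3.6)`, while the bound on the circle is a constant times `q^0.905`. The product is a constant
times `q^(-2.695)`, and the factor `q^(-0.195) ≤ 1/2` absorbs the excess of the constant.
-/

namespace LaurentStieltjes

open Finset MeasureTheory Filter Asymptotics

/-! ### Partial sums of a character -/

/-- The partial sum `∑_{1 ≤ k ≤ n} χ(k)`. -/
noncomputable def charSum {q : ℕ} (χ : DirichletCharacter ℂ q) (n : ℕ) : ℂ :=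
  ∑ k ∈ Icc 1 n, χ (k : ZMod q)

theorem norm_charSum_le_self {q : ℕ} (χ : DirichletCharacter ℂ q) (n : ℕ) :
    ‖charSum χ n‖ ≤ n := by
  have h := norm_sum_le_of_le (Icc 1 n) (f := fun k : ℕ => χ (k : ZMod q)) (n := fun _ => 1)
    fun k _ => χ.norm_le_one (k : ZMod q)
  simpa [charSum] using h

theorem charSum_eq_sum_range {q : ℕ} (χ : DirichletCharacter ℂ q) (n : ℕ) :
    charSum χ n = ∑ k ∈ range n, χ ((k + 1 : ℕ) : ZMod q) := by
  rw [charSum, range_eq_Ico, sum_Ico_add' (fun k : ℕ => χ (k : ZMod q)) 0 n 1]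
  rfl

theorem charSum_modulus {q : ℕ} [NeZero q] {χ : DirichletCharacter ℂ q} (hχ : χ ≠ 1) :
    charSum χ q = 0 := by
  have h0 : ∑ a : ZMod q, χ (a + 1) = 0 := by
    rw [← MulChar.sum_eq_zero_of_ne_one hχ]
    exact Equiv.sum_comp (Equiv.addRight (1 : ZMod q)) (fun a => χ a)
  rw [charSum_eq_sum_range, ← h0]
  refine sum_bij' (fun k _ => (k : ZMod q)) (fun a _ => a.val) ?_ ?_ ?_ ?_ ?_
  · simp
  · intro a _
    exact mem_range.mpr a.val_lt
  · intro k hk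
    exact ZMod.val_cast_of_lt (mem_range.mp hk)
  · intro a _
    exact ZMod.natCast_zmod_val a
  · simp

theorem periodic_charSum {q : ℕ} [NeZero q] {χ : DirichletCharacter ℂ q} (hχ : χ ≠ 1) :
    Function.Periodic (charSum χ) q := by
  intro n
  have h := charSum_modulus hχ
  rw [charSum_eq_sum_range] at h
  rw [add_comm, charSum_eq_sum_range, sum_range_add, h, zero_add, charSum_eq_sum_range]
  simp

theorem norm_charSum_le_modulus {q : ℕ} [NeZero q] {χ : DirichletCharacter ℂ q} (hχ : χ ≠ 1)
    (n : ℕ) : ‖charSum χ n‖ ≤ q := by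
  rw [← (periodic_charSum hχ).map_mod_nat n]
  refine (norm_charSum_le_self χ _).trans ?_
  exact_mod_cast (Nat.mod_lt n (NeZero.pos q)).le

theorem measurable_charSum_floor {q : ℕ} (χ : DirichletCharacter ℂ q) :
    Measurable fun t : ℝ => charSum χ ⌊t⌋₊ :=
  (measurable_from_nat (f := charSum χ)).comp Nat.measurable_floor

/-! ### Analytic continuation by Abel summation -/

/-- The integral `∫_1^∞ S(t) t^(-s-1) dt` is the Mellin transform at `-s` of `S` restricted to
`(1, ∞)`, so it is holomorphic for `Re s > 0`. -/
theorem differentiableAt_integral_charSum {q : ℕ} [NeZero q] {χ : DirichletCharacter ℂ q}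
    (hχ : χ ≠ 1) {s : ℂ} (hs : 0 < s.re) :
    DifferentiableAt ℂ
      (fun z : ℂ => ∫ t in Set.Ioi (1 : ℝ), charSum χ ⌊t⌋₊ * (t : ℂ) ^ (-(z + 1))) s := by
  set g : ℝ → ℂ := (Set.Ioi (1 : ℝ)).indicator fun t => charSum χ ⌊t⌋₊ with hg
  have hgm : Measurable g := (measurable_charSum_floor χ).indicator measurableSet_Ioi
  have hgb (t : ℝ) : ‖g t‖ ≤ q :=
    (norm_indicator_le_norm_self _ _).trans (norm_charSum_le_modulus hχ _)
  have hmellin : (fun z : ℂ => ∫ t in Set.Ioi (1 : ℝ), charSum χ ⌊t⌋₊ * (t : ℂ) ^ (-(z + 1)))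
      = fun z => mellin g (-z) := by
    funext z
    have hind : (fun t : ℝ => (t : ℂ) ^ (-z - 1) • g t) = (Set.Ioi (1 : ℝ)).indicator
        fun t => charSum χ ⌊t⌋₊ * (t : ℂ) ^ (-(z + 1)) := by
      funext t
      by_cases ht : t ∈ Set.Ioi (1 : ℝ)
      · simp only [hg, Set.indicator_of_mem ht, smul_eq_mul]
        rw [mul_comm, neg_add']
      · simp only [hg, Set.indicator_of_notMem ht, smul_zero]
    rw [mellin, hind, setIntegral_indicator measurableSet_Ioi,
      Set.inter_eq_right.mpr (Set.Ioi_subset_Ioi zero_le_one)]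
  rw [hmellin]
  have hloc : LocallyIntegrableOn g (Set.Ioi 0) := by
    refine LocallyIntegrable.locallyIntegrableOn ?_ _
    refine (locallyIntegrable_const (q : ℝ)).mono hgm.aestronglyMeasurable ?_
    refine Eventually.of_forall fun t => (hgb t).trans (le_abs_self _)
  have htop : g =O[atTop] fun t : ℝ => t ^ (-(0 : ℝ)) := by
    refine IsBigO.of_bound (q : ℝ) (Eventually.of_forall fun t => ?_)
    simpa using hgb t
  -- `g` vanishes near `0`, so any exponent below `-Re s` serves there.
  have hbot : g =O[𝓝[>] 0] fun t : ℝ => t ^ (-(-s.re - 1)) := by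
    have h0 : g =ᶠ[𝓝[>] 0] fun _ => 0 := by
      filter_upwards [mem_nhdsWithin_of_mem_nhds (Iio_mem_nhds (zero_lt_one (α := ℝ)))] with t ht
      exact Set.indicator_of_notMem (fun h => lt_asymm h ht) _
    exact h0.trans_isBigO (isBigO_zero _ _)
  have hd : DifferentiableAt ℂ (mellin g) (-s) :=
    mellin_differentiableAt_of_isBigO_rpow hloc htop (by simpa using hs) hbot (by simp)
  exact hd.comp s differentiableAt_id.neg

/-- Abel summation gives the formula for `Re s > 1`; both sides are holomorphic for `Re s > 0`,
since the partial sums of a non-principal character are bounded. -/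
theorem LFunction_eq_mul_integral {q : ℕ} [NeZero q] {χ : DirichletCharacter ℂ q} (hχ : χ ≠ 1)
    {s : ℂ} (hs : 0 < s.re) :
    χ.LFunction s
      = s * ∫ t in Set.Ioi (1 : ℝ), charSum χ ⌊t⌋₊ * (t : ℂ) ^ (-(s + 1)) := by
  have hopen : IsOpen {z : ℂ | 0 < z.re} := isOpen_lt continuous_const Complex.continuous_re
  have hF : AnalyticOnNhd ℂ (fun z : ℂ => z * ∫ t in Set.Ioi (1 : ℝ),
      charSum χ ⌊t⌋₊ * (t : ℂ) ^ (-(z + 1))) {z : ℂ | 0 < z.re} := by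
    refine DifferentiableOn.analyticOnNhd (fun z hz => ?_) hopen
    exact (differentiableAt_id.mul (differentiableAt_integral_charSum hχ hz)).differentiableWithinAt
  have hL : AnalyticOnNhd ℂ χ.LFunction {z : ℂ | 0 < z.re} :=
    (DirichletCharacter.differentiable_LFunction hχ).differentiableOn.analyticOnNhd hopen
  have hpre : IsPreconnected {z : ℂ | 0 < z.re} :=
    (convex_halfSpace_re_gt 0).isPreconnected
  refine hL.eqOn_of_preconnected_of_eventuallyEq hF hpre (z₀ := 2) (by simp) ?_ hs
  have hnear : {z : ℂ | 1 < z.re} ∈ 𝓝 (2 : ℂ) :=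
    (isOpen_lt continuous_const Complex.continuous_re).mem_nhds (by simp)
  filter_upwards [hnear] with z hz
  have hz' : 1 < z.re := hz
  rw [DirichletCharacter.LFunction_eq_LSeries χ hz']
  refine LSeries_eq_mul_integral (fun n : ℕ => χ (n : ZMod q)) zero_le_one hz'
    (DirichletCharacter.LSeriesSummable_of_one_lt_re χ hz') ?_
  refine IsBigO.of_bound 1 (Eventually.of_forall fun n => ?_)
  simpa [charSum] using norm_charSum_le_self χ n

/-! ### The bound in the half-plane of positive real part -/

/-- The two parts of the integral, cut at `t = q`, contribute `q^(1-σ) / (1-σ)` through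
`|S(t)| ≤ t` and `q^(1-σ) / σ` through `|S(t)| ≤ q`. -/
theorem norm_LFunction_le {q : ℕ} [NeZero q] {χ : DirichletCharacter ℂ q} (hχ : χ ≠ 1)
    {σ : ℝ} (h0 : 0 < σ) (h1 : σ < 1) {s : ℂ} (hs : σ ≤ s.re) :
    ‖χ.LFunction s‖ ≤ ‖s‖ * ((q : ℝ) ^ (1 - σ) / (σ * (1 - σ))) := by
  have hq : (1 : ℝ) ≤ q := by exact_mod_cast NeZero.one_le
  have hq0 : (0 : ℝ) < q := by linarith
  rw [LFunction_eq_mul_integral hχ (h0.trans_le hs), norm_mul]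
  gcongr
  have hkernel {t : ℝ} (ht : 1 ≤ t) : ‖(t : ℂ) ^ (-(s + 1))‖ ≤ t ^ (-σ - 1) := by
    rw [Complex.norm_cpow_eq_rpow_re_of_pos (by linarith)]
    refine Real.rpow_le_rpow_of_exponent_le ht ?_
    simp only [Complex.neg_re, Complex.add_re, Complex.one_re]
    linarith
  have hsmall : ∀ t ∈ Set.Ioc (1 : ℝ) q,
      ‖charSum χ ⌊t⌋₊ * (t : ℂ) ^ (-(s + 1))‖ ≤ t ^ (-σ) := by
    intro t ht
    have ht0 : 0 < t := by linarith [ht.1]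
    calc ‖charSum χ ⌊t⌋₊ * (t : ℂ) ^ (-(s + 1))‖ ≤ t * t ^ (-σ - 1) := by
          rw [norm_mul]
          gcongr
          · exact (norm_charSum_le_self χ _).trans (Nat.floor_le ht0.le)
          · exact hkernel ht.1.le
      _ = t ^ (-σ) := by
          rw [Real.rpow_sub_one ht0.ne']
          field_simp
  have hlarge : ∀ t ∈ Set.Ioi (q : ℝ),
      ‖charSum χ ⌊t⌋₊ * (t : ℂ) ^ (-(s + 1))‖ ≤ q * t ^ (-σ - 1) := by
    intro t ht
    rw [norm_mul]
    gcongr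
    · exact norm_charSum_le_modulus hχ _
    · exact hkernel (hq.trans (le_of_lt ht))
  have hmeas : Measurable fun t : ℝ => charSum χ ⌊t⌋₊ * (t : ℂ) ^ (-(s + 1)) :=
    (measurable_charSum_floor χ).mul (by fun_prop)
  have hint1 : IntegrableOn (fun t : ℝ => t ^ (-σ)) (Set.Ioc 1 q) :=
    (intervalIntegral.intervalIntegrable_rpow' (by linarith)).1
  have hint2 : IntegrableOn (fun t : ℝ => (q : ℝ) * t ^ (-σ - 1)) (Set.Ioi q) :=
    (integrableOn_Ioi_rpow_of_lt (by linarith) hq0).const_mul _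
  have hb1 : ‖∫ t in Set.Ioc (1 : ℝ) q, charSum χ ⌊t⌋₊ * (t : ℂ) ^ (-(s + 1))‖
      ≤ (q : ℝ) ^ (1 - σ) / (1 - σ) := by
    refine (norm_integral_le_of_norm_le hint1
      ((ae_restrict_iff' measurableSet_Ioc).mpr (Eventually.of_forall hsmall))).trans ?_
    rw [← intervalIntegral.integral_of_le hq, integral_rpow (Or.inl (by linarith)),
      Real.one_rpow, neg_add_eq_sub]
    have : 0 < 1 - σ := by linarith
    gcongr
    linarith
  have hb2 : ‖∫ t in Set.Ioi (q : ℝ), charSum χ ⌊t⌋₊ * (t : ℂ) ^ (-(s + 1))‖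
      ≤ (q : ℝ) ^ (1 - σ) / σ := by
    refine (norm_integral_le_of_norm_le hint2
      ((ae_restrict_iff' measurableSet_Ioi).mpr (Eventually.of_forall hlarge))).trans ?_
    rw [integral_const_mul, integral_Ioi_rpow_of_lt (by linarith) hq0, sub_add_cancel,
      sub_eq_add_neg 1 σ, Real.rpow_one_add' hq0.le (by linarith), neg_div_neg_eq, mul_div_assoc]
  have hi1 : IntegrableOn (fun t : ℝ => charSum χ ⌊t⌋₊ * (t : ℂ) ^ (-(s + 1))) (Set.Ioc 1 q) :=
    hint1.mono' hmeas.aestronglyMeasurable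
      ((ae_restrict_iff' measurableSet_Ioc).mpr (Eventually.of_forall hsmall))
  have hi2 : IntegrableOn (fun t : ℝ => charSum χ ⌊t⌋₊ * (t : ℂ) ^ (-(s + 1))) (Set.Ioi q) :=
    hint2.mono' hmeas.aestronglyMeasurable
      ((ae_restrict_iff' measurableSet_Ioi).mpr (Eventually.of_forall hlarge))
  rw [← Set.Ioc_union_Ioi_eq_Ioi hq, setIntegral_union Set.Ioc_disjoint_Ioi_same
    measurableSet_Ioi hi1 hi2]
  refine (norm_add_le _ _).trans ((add_le_add hb1 hb2).trans_eq ?_)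
  have : 1 - σ ≠ 0 := by linarith
  field_simp
  ring

/-! ### The Taylor remainder -/

/-- Cauchy's estimate on the circle of radius `R` bounds the `n`-th Taylor term at distance at most
`r` by `C (r / R)^n`; the remainder is then a geometric tail. -/
theorem norm_sub_sum_taylor_le {f : ℂ → ℂ} (hf : Differentiable ℂ f) {c z : ℂ} {r R C : ℝ}
    (hr : 0 < r) (hrR : r < R) (hC : ∀ w ∈ Metric.sphere c R, ‖f w‖ ≤ C) (hz : ‖z - c‖ ≤ r)
    (m : ℕ) :
    ‖f z - ∑ n ∈ range m, iteratedDeriv n f c / (n.factorial : ℂ) * (z - c) ^ n‖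
      ≤ C * (r / R) ^ m / (1 - r / R) := by
  have hR : 0 < R := hr.trans hrR
  have hx0 : 0 ≤ r / R := by positivity
  have hx1 : r / R < 1 := (div_lt_one hR).mpr hrR
  have hsum : HasSum (fun n : ℕ => iteratedDeriv n f c / (n.factorial : ℂ) * (z - c) ^ n)
      (f z) := by
    refine (Complex.hasSum_taylorSeries_of_entire hf c z).congr_fun ?_
    intro n
    simp only [smul_eq_mul]
    ring
  have hterm (n : ℕ) : ‖iteratedDeriv n f c / (n.factorial : ℂ) * (z - c) ^ n‖
      ≤ C * (r / R) ^ n := by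
    have hcauchy := Complex.norm_iteratedDeriv_le_of_forall_mem_sphere_norm_le n hR
      hf.diffContOnCl hC
    have hfac : (0 : ℝ) < n.factorial := by exact_mod_cast n.factorial_pos
    rw [norm_mul, norm_div, norm_pow, Complex.norm_natCast]
    calc ‖iteratedDeriv n f c‖ / n.factorial * ‖z - c‖ ^ n
        ≤ (n.factorial * C / R ^ n) / n.factorial * r ^ n := by
          gcongr
          exact div_nonneg ((norm_nonneg _).trans hcauchy) hfac.le
      _ = C * (r / R) ^ n := by
          rw [div_pow]
          field_simp
  have hgeo : HasSum (fun n : ℕ => C * (r / R) ^ (n + m)) (C * (r / R) ^ m / (1 - r / R)) := by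
    have h := (hasSum_geometric_of_lt_one hx0 hx1).mul_left (C * (r / R) ^ m)
    rw [← div_eq_mul_inv] at h
    refine h.congr_fun fun n => ?_
    rw [pow_add]
    ring
  exact ((hasSum_nat_add_iff' m).mpr hsum).norm_le_of_bounded hgeo fun n => hterm (n + m)

/-! ### Numerical estimates -/

theorem exp_neg_tenth_le : Real.exp (-(1 / 10)) ≤ 0.905 := by
  have h := Real.quadratic_le_exp_of_nonneg (x := 1 / 10) (by norm_num)
  rw [Real.exp_neg]
  refine (inv_anti₀ (by norm_num) h).trans (by norm_num)

theorem exp_neg_nine_tenths_le : Real.exp (-(9 / 10)) ≤ 0.41 := by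
  have h1 := Real.add_one_le_exp (-(1 / 10 : ℝ))
  have h2 := Real.exp_one_gt_d9
  have h3 : Real.exp (9 / 10) = Real.exp 1 * Real.exp (-(1 / 10)) := by
    rw [← Real.exp_add]
    norm_num
  have h4 : (2.44 : ℝ) ≤ Real.exp (9 / 10) := by
    rw [h3]
    nlinarith
  rw [Real.exp_neg]
  refine (inv_anti₀ (by norm_num) h4).trans (by norm_num)

/-- The exponent `⌊4 log q⌋ + 1` exceeds `4 log q`, and `4 * 9 / 10 = 3.6`. -/
theorem exp_pow_floor_log_le {q : ℕ} (hq : 1 ≤ q) :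
    Real.exp (-(9 / 10)) ^ (⌊4 * Real.log (q : ℝ)⌋₊ + 1) ≤ (q : ℝ) ^ (-3.6 : ℝ) := by
  have hq0 : (0 : ℝ) < q := by exact_mod_cast hq
  have hfl := Nat.lt_floor_add_one (4 * Real.log (q : ℝ))
  rw [← Real.exp_nat_mul, Real.rpow_def_of_pos hq0]
  refine Real.exp_le_exp.mpr ?_
  push_cast
  linarith

theorem two_le_rpow {x : ℝ} (hx : 150 ≤ x) : 2 ≤ x ^ (0.195 : ℝ) := by
  calc (2 : ℝ) = ((2 : ℝ) ^ (7 : ℝ)) ^ (1 / 7 : ℝ) := by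
        rw [← Real.rpow_mul (by norm_num)]
        norm_num
    -- `2 ^ 7 = 128 ≤ 150`
    _ ≤ x ^ (1 / 7 : ℝ) := by
        gcongr
        norm_num
        linarith
    _ ≤ x ^ (0.195 : ℝ) := Real.rpow_le_rpow_of_exponent_le (by linarith) (by norm_num)

/-- The principal character has conductor `1`, so it is primitive only modulo `1`. -/
theorem ne_one_of_isPrimitive {q : ℕ} (hq : q ≠ 1) {χ : DirichletCharacter ℂ q} [NeZero q]
    (hχ : χ.IsPrimitive) : χ ≠ 1 := by
  rintro rfl
  rw [DirichletCharacter.isPrimitive_def, DirichletCharacter.conductor_one] at hχ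
  exact hq hχ.symm

end LaurentStieltjes

open LaurentStieltjes in
theorem mainTheorem1 (q : ℕ) [NeZero q] (hq : 150 ≤ q) (χ : DirichletCharacter ℂ q)
    (hχ : χ.IsPrimitive) (s : ℂ) (hs : ‖s - 1‖ ≤ Real.exp (-1)) :
    ‖χ.LFunction s -
        ∑ n ∈ Finset.range (⌊4 * Real.log (q : ℝ)⌋₊ + 1),
          (-1) ^ n * LaurentStieltjes.laurentStieltjes χ n / (n.factorial : ℂ) * (s - 1) ^ n‖
      ≤ 32.3 / (q : ℝ) ^ (2.5 : ℝ) := by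
  have hχ1 : χ ≠ 1 := ne_one_of_isPrimitive (by omega) hχ
  have hqR : (150 : ℝ) ≤ q := by exact_mod_cast hq
  have hq0 : (0 : ℝ) < q := by linarith
  have hcircle : ∀ w ∈ Metric.sphere (1 : ℂ) (Real.exp (-(1 / 10))),
      ‖χ.LFunction w‖ ≤ 22.16 * (q : ℝ) ^ (0.905 : ℝ) := by
    intro w hw
    have hdist : ‖w - 1‖ ≤ 0.905 := (mem_sphere_iff_norm.mp hw).trans_le exp_neg_tenth_le
    -- The circle stays in the half-plane `Re w ≥ 1 - 0.905`.
    have hre : 0.095 ≤ w.re := by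
      have h := (abs_le.mp ((Complex.abs_re_le_norm (w - 1)).trans hdist)).1
      rw [Complex.sub_re, Complex.one_re] at h
      linarith
    have hnorm : ‖w‖ ≤ 1.905 := by
      have h := norm_add_le (w - 1) 1
      rw [sub_add_cancel, norm_one] at h
      linarith
    have hbound := norm_LFunction_le hχ1 (σ := 0.095) (by norm_num) (by norm_num) hre
    have hexp : (1 - 0.095 : ℝ) = 0.905 := by norm_num
    rw [hexp] at hbound
    have hpos : 0 < (q : ℝ) ^ (0.905 : ℝ) := by positivity
    calc ‖χ.LFunction w‖ ≤ ‖w‖ * ((q : ℝ) ^ (0.905 : ℝ) / (0.095 * 0.905)) := hbound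
      _ ≤ 1.905 * ((q : ℝ) ^ (0.905 : ℝ) / (0.095 * 0.905)) := by gcongr
      _ = 1.905 / (0.095 * 0.905) * (q : ℝ) ^ (0.905 : ℝ) := by ring
      _ ≤ 22.16 * (q : ℝ) ^ (0.905 : ℝ) := by
          gcongr
          norm_num
  have htaylor := norm_sub_sum_taylor_le (DirichletCharacter.differentiable_LFunction hχ1)
    (Real.exp_pos (-1)) (Real.exp_lt_exp.mpr (by norm_num)) hcircle hs
    (⌊4 * Real.log (q : ℝ)⌋₊ + 1)
  have hratio : Real.exp (-1) / Real.exp (-(1 / 10)) = Real.exp (-(9 / 10)) := by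
    rw [← Real.exp_sub]
    norm_num
  rw [hratio] at htaylor
  simp only [laurentStieltjes_of_ne_one hχ1]
  refine htaylor.trans ?_
  have hden : (0.59 : ℝ) ≤ 1 - Real.exp (-(9 / 10)) := by
    linarith [exp_neg_nine_tenths_le]
  calc 22.16 * (q : ℝ) ^ (0.905 : ℝ) * Real.exp (-(9 / 10)) ^ (⌊4 * Real.log (q : ℝ)⌋₊ + 1)
        / (1 - Real.exp (-(9 / 10)))
      ≤ 22.16 * (q : ℝ) ^ (0.905 : ℝ) * (q : ℝ) ^ (-3.6 : ℝ) / 0.59 := by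
        gcongr
        exact exp_pow_floor_log_le (by omega)
    _ = 22.16 / 0.59 / (q : ℝ) ^ (0.195 : ℝ) / (q : ℝ) ^ (2.5 : ℝ) := by
        rw [mul_assoc, ← Real.rpow_add hq0, div_div (22.16 / 0.59 : ℝ), ← Real.rpow_add hq0,
          div_eq_mul_inv _ ((q : ℝ) ^ _), ← Real.rpow_neg hq0.le]
        norm_num
        ring
    _ ≤ 22.16 / 0.59 / 2 / (q : ℝ) ^ (2.5 : ℝ) := by
        gcongr
        exact two_le_rpow hqR
    _ ≤ 32.3 / (q : ℝ) ^ (2.5 : ℝ) := by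
        gcongr
        norm_num
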